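/- **Setting.** Let $(X,O)$ be a germ of smooth complex surface and $\pi:X'\to X$ a composition of blow-ups of a finite non-empty set $K$ of points equal or infinitely near to $O$ ($K$ contains $O$ and, with each point, all its predecessors). Write $q\to p$ if $q\in K$ is proximate to $p\in K$ (that is, $q$ lies on the strict transform of the exceptional curve of $p$), $E_p$ and $\overline E_p$ for the strict and total transforms of the exceptional curve of $p$, and $\Lambda_\pi=\bigoplus_{p\in K}\mathbb Z E_p$. For $D=\sum_p v_p(D)E_p=\sum_p e_p(D)\overline E_p\in\Lambda_\pi$ let $\rho_p(D)=-D\cdot E_p$ and $\mathrm{Supp}_{\overline E}(D)=\{p\in K: e_p(D)\neq 0\}$; $D$ is antinef if it is effective and $\rho_p(D)\ge 0$ for all $p\in K$. Let $\{B_p\}_{p\in K}$ be the basis of $\Lambda_\pi$ dual to $\{-E_p\}_{p\in K}$ for the intersection form; the $B_p$ are the simple divisors, and $D=\sum_p\rho_p(D)B_p$. The antinef closure of $D$ is the least antinef divisor $\ge D$. The unloading procedure applied to $D$ repeats the pass $D\mapsto D+\sum_{\rho_p(D)<0}\lceil \rho_p(D)/E_p^2\rceil E_p$ until the result is antinef.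 For $f\in\mathcal O_{X,O}\setminus\{0\}$ let $v_p(f)$ be the order of vanishing of $\pi^*f$ along $E_p$, let $\mathrm{Div}(\pi^*f)_{\rm exc}=\sum_p v_p(f)E_p$, and let $e_p(f)$ be the multiplicities of this divisor. A dead-end is a $p\in K$ whose removal leaves the dual graph of the exceptional divisor connected (or empty); a set of maximal contact elements of $\pi$ is a family $f_p\in\mathcal O_{X,O}$, indexed by the dead-ends $p$, with $\mathrm{Div}(\pi^*f_p)_{\rm exc}=B_p$. A point of $K$ is free if it is proximate to exactly one point. **Algorithm.** Input: an antinef divisor $D=D^{(0)}\in\Lambda_\pi$; a set $\{f_\tau\}$ of maximal contact elements is fixed. Step $(i)$, with divisor $D^{(i)}$, does the following for each $q\in K$ with $\rho_q(D^{(i)})>0$. * If $B_q=B_O$: take as generators of $H_{B_q}$ two elements $f_{i_0},f_{i_1}$ that are smooth and transverse at $O$. * Otherwise: perform unloading on $B_q+E_O$, with output $\widehat D$; let $p$ be the last free point with $e_p(B_q)\ne0$, and choose $\tau$ with $e_p(f_\tau)=1$ and $e_O(f_\tau)\le e_O(B_q)$ for which $n=e_O(B_q)/e_O(f_\tau)$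 is an integer; perform step $(i+1)$ recursively with $D^{(i+1)}=\widehat D$; take as generators of $H_{B_q}$ the element $f_\tau^{n}$ and the generators returned for $H_{\widehat D}$. Then it forms the products of generators corresponding to $\prod_q H_{B_q}^{\rho_q(D^{(i)})}$, keeps those products $h$ with $\pi^*h\notin\mathcal O_{X'}(-D^{(i)}-\overline E_O)$, and returns them as generators of $H_{D^{(i)}}$. **Proposition.** 1. For every simple divisor $B_q\ne B_O$, the unloading procedure applied to $B_q+E_O$ stops after finitely many passes; its output $\widehat D$ is the antinef closure of $B_q+E_O$. Moreover $e_q(B_q)=1$, $e_q(\widehat D)=0$, and $\mathrm{Supp}_{\overline E}(\widehat D)\subsetneq\mathrm{Supp}_{\overline E}(B_q)$; in particular $|\mathrm{Supp}_{\overline E}(\widehat D)|<|\mathrm{Supp}_{\overline E}(B_q)|$. 2. For every antinef $D\in\Lambda_\pi$ the algorithm ends after finitely many steps: there is a bound, depending only on $\pi$ and $D$, for the length of the chains $D=D^{(0)},D^{(1)},D^{(2)},\dots$ of divisors in which each $D^{(i+1)}$ is the output of unloading $B_q+E_O$ for some $q$ with $\rho_q(D^{(i)})>0$ and $B_q\neq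 B_O$; and there is a bound, depending only on $\pi$ and $D$, for the total number of elementary steps (decompositions, passes of unloading, selections, recursive calls and returns, products) of any execution of the algorithm on $D$, whatever set of maximal contact elements is fixed and whatever choices are made. -/

import Mathlib

open Topology
open scoped Pointwise

noncomputable section

namespace PlaneCluster

/-! ### Points infinitely near to the origin of a smooth surface germ

In local coordinates the germ `(X, O)` of a smooth complex surface is `(ℂ², 0)`.  The exceptional
curve of the blow-up of a point is the projective line of tangent directions at that point, so
a point infinitely near to `O` is obtained from `O` by choosing successively points on the last
exceptional curve.  With local coordinates `(u, v)` at `p`, the element `c : ℂ` of `OnePoint ℂ`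
is the direction of the line `v = c u`, and `∞` is the direction of the line `u = 0`. -/

/-- The points equal or infinitely near to `O`. `near p t` is the point with direction `t` on the
exceptional curve of the blow-up of `p`. -/
inductive Pt : Type
  | O : Pt
  | near (p : Pt) (t : OnePoint ℂ) : Pt

instance : DecidableEq Pt := Classical.decEq _

namespace Pt

/-- The blow-down map, in local coordinates at the infinitely near point and at `O`.
At `near p c` the coordinates are `(u', v') = (u, v / u - c)`;
at `near p ∞` they are `(u', v') = (u / v, v)`. -/
def chart : Pt → ℂ × ℂ → ℂ × ℂ
  | O, z => z
  | near p none, z => chart p (z.1 * z.2, z.2)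
  | near p (some c), z => chart p (z.1, z.1 * (z.2 + c))

/-- The point `p` (if any) such that the strict transform of the exceptional curve `E_p` passes
through the given point with local equation `u = 0`. -/
def axisU : Pt → Option Pt
  | O => none
  | near p none => axisU p
  | near p (some _) => some p

open scoped Classical in
/-- The point `p` (if any) such that the strict transform of the exceptional curve `E_p` passes
through the given point with local equation `v = 0`. -/
def axisV : Pt → Option Pt
  | O => none
  | near p none => some p
  | near p (some c) => if c = 0 then axisV p else none

/-- `q` is proximate to `p`, written `q → p` : the point `q` lies on the strict transform of the
exceptional curve `E_p`. -/
def Proximate (q p : Pt) : Prop := axisU q = some p ∨ axisV q = some p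

/-- `q` is equal or infinitely near to `p`, i.e. `p ≤ q`. -/
def Precedes (p : Pt) : Pt → Prop
  | O => p = O
  | near q t => p = near q t ∨ Precedes p q

/-- The number of centres at or before a point, minus one. -/
def depth : Pt → ℕ
  | O => 0
  | near p _ => depth p + 1

theorem axis_depth (q : Pt) :
    (∀ p, axisU q = some p → p.depth < q.depth) ∧ ∀ p, axisV q = some p → p.depth < q.depth := by
  induction q with
  | O => simp [axisU, axisV]
  | near r t ih =>
    cases t with
    | infty =>
      refine ⟨fun p hp => ?_, fun p hp => ?_⟩
      · exact (ih.1 p hp).trans (Nat.lt_succ_self _)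
      · have h : r = p := Option.some.inj hp
        subst h
        exact Nat.lt_succ_self _
    | coe c =>
      refine ⟨fun p hp => ?_, fun p hp => ?_⟩
      · have h : r = p := Option.some.inj hp
        subst h
        exact Nat.lt_succ_self _
      · have hp' : (if c = 0 then axisV r else none) = some p := hp
        split_ifs at hp' with h
        exact (ih.2 p hp').trans (Nat.lt_succ_self _)

theorem Proximate.depth_lt {q p : Pt} (h : Proximate q p) : p.depth < q.depth :=
  h.elim ((axis_depth q).1 p) ((axis_depth q).2 p)

end Pt

/-- A proper birational morphism `π : X' → X` of smooth surfaces with connected exceptional locus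
over `O` is the composition of the blow-ups of finitely many points equal or
infinitely near to `O`.  It is given by the set `K` of the points that are blown up. -/
structure Cluster : Type where
  pts : Finset Pt
  origin_mem : Pt.O ∈ pts
  closed : ∀ p t, Pt.near p t ∈ pts → p ∈ pts

namespace Cluster

variable (K : Cluster)

/-- The origin as a point of the cluster. -/
def origin : K.pts := ⟨Pt.O, K.origin_mem⟩

/-- The lattice `Λ_π` of exceptional divisors `D = ∑ v_p E_p`; a divisor is given by its values,
its coordinates in the basis of strict transforms. -/
abbrev Div : Type := K.pts → ℤ

open scoped Classical in
/-- The proximity matrix: `1` on the diagonal, `-1` at `(q, p)` if `q → p`, `0` otherwise. -/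
def proximity : Matrix K.pts K.pts ℤ :=
  Matrix.of fun q p => if q = p then 1 else if Pt.Proximate q p then -1 else 0

/-- The multiplicities `e_p(D)`: the coordinates of `D` in the basis of total transforms. They
satisfy `v_q(D) = e_q(D) + ∑_{q → p} v_p(D)`, that is `e = P v`. -/
def mult (D : K.Div) : K.pts → ℤ := K.proximity.mulVec D

/-- The intersection number `D · C`: the total transforms of the exceptional curves are orthogonal
with self-intersection `-1`. -/
def inter (D C : K.Div) : ℤ := -∑ p, K.mult D p * K.mult C p

/-- The strict transform `E_p` of the exceptional curve of `p`, as an element of `Λ_π`. -/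
def strict (p : K.pts) : K.Div := Pi.single p 1

/-- The total transform of the exceptional curve of `p`, as an element of `Λ_π`. -/
def total (p : K.pts) : K.Div := fun q => (K.proximity⁻¹) q p

/-- The excess `ρ_p(D) = - D · E_p`. -/
def excess (D : K.Div) (p : K.pts) : ℤ := -K.inter D (K.strict p)

/-- The branch basis `B_q`: the basis dual to `(-E_p)` for the intersection form. -/
def branch (q : K.pts) : K.Div :=
  fun p => ((Matrix.of fun a b => -K.inter (K.strict a) (K.strict b))⁻¹ : Matrix _ _ ℤ) p q

/-! The next facts check that the two matrix inverses above are genuine. -/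

theorem det_proximity : K.proximity.det = 1 := by
  have hb : Matrix.BlockTriangular K.proximity.transpose (fun p : K.pts => p.1.depth) := by
    intro i j hij
    have h1 : j ≠ i := by
      rintro rfl
      exact lt_irrefl _ hij
    have h2 : ¬ Pt.Proximate j.1 i.1 := fun h => absurd (h.depth_lt) (not_lt.mpr hij.le)
    simp [proximity, Matrix.transpose_apply, h1, h2]
  rw [← Matrix.det_transpose, hb.det]
  refine Finset.prod_eq_one fun k _ => ?_
  have : K.proximity.transpose.toSquareBlock (fun p : K.pts => p.1.depth) k = 1 := by
    ext i j
    by_cases h : i = j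
    · subst h
      simp [Matrix.toSquareBlock, Matrix.toSquareBlockProp, proximity]
    · have h1 : j.1 ≠ i.1 := fun h' => h (Subtype.ext h'.symm)
      have h2 : ¬ Pt.Proximate j.1.1 i.1.1 := fun h' => by
        have := h'.depth_lt
        have e1 := i.2
        have e2 := j.2
        omega
      simp [Matrix.toSquareBlock, Matrix.toSquareBlockProp, proximity, h, h1, h2]
  rw [this, Matrix.det_one]

theorem mult_total (p : K.pts) : K.mult (K.total p) = Pi.single p 1 := by
  have h : K.proximity * K.proximity⁻¹ = 1 :=
    Matrix.mul_nonsing_inv _ (by rw [det_proximity]; exact isUnit_one)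
  funext q
  have := congrFun (congrFun h q) p
  rw [Matrix.mul_apply, Matrix.one_apply] at this
  rw [Pi.single_apply]
  exact this

theorem neg_inter_matrix :
    (Matrix.of fun a b => -K.inter (K.strict a) (K.strict b) : Matrix K.pts K.pts ℤ)
      = K.proximity.transpose * K.proximity := by
  classical
  ext a b
  simp [inter, strict, mult, Matrix.mul_apply]

theorem excess_branch (q p : K.pts) : K.excess (K.branch q) p = if p = q then 1 else 0 := by
  have hu : IsUnit (K.proximity.transpose * K.proximity).det := by
    rw [Matrix.det_mul, Matrix.det_transpose, det_proximity]
    exact isUnit_one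
  have h := Matrix.mul_nonsing_inv _ hu
  have h' := congrFun (congrFun h p) q
  rw [Matrix.one_apply, Matrix.mul_assoc, Matrix.mul_apply] at h'
  rw [← h']
  simp only [excess, inter, neg_neg, mult, strict]
  refine Finset.sum_congr rfl fun r _ => ?_
  rw [Matrix.mulVec_single_one, mul_comm]
  have hb : K.branch q = fun s => (K.proximity.transpose * K.proximity)⁻¹ s q := by
    funext s
    rw [branch, neg_inter_matrix]
  rw [hb]
  rfl

/-- An exceptional divisor is antinef if it is effective and `D · E_p ≤ 0` for all `p`. -/
def Antinef (D : K.Div) : Prop := 0 ≤ D ∧ ∀ p, 0 ≤ K.excess D p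

/-- The support in the basis of total transforms. -/
def totalSupport (D : K.Div) : Set K.pts := {p | K.mult D p ≠ 0}

/-! ### Unloading -/

open scoped Classical in
/-- One pass of the unloading procedure: add `⌈ρ_p / E_p²⌉ E_p` for all `p` with `ρ_p < 0`. -/
def unloadPass (D : K.Div) : K.Div := fun p =>
  if K.excess D p < 0 then
    D p + ⌈(K.excess D p : ℚ) / (K.inter (K.strict p) (K.strict p) : ℚ)⌉
  else D p

/-- The unloading procedure (repeat passes until the divisor is antinef) started at the
first divisor stops, and its output is the second one. -/
inductive Unloads : K.Div → K.Div → Prop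
  | final (D : K.Div) : K.Antinef (K.unloadPass D) → Unloads D (K.unloadPass D)
  | again (D C : K.Div) : ¬ K.Antinef (K.unloadPass D) → Unloads (K.unloadPass D) C → Unloads D C

/-- `C` is the antinef closure of `D`: the least antinef divisor that is at least `D`. -/
def IsAntinefClosure (D C : K.Div) : Prop := IsLeast {Z | K.Antinef Z ∧ D ≤ Z} C

/-! ### Germs of functions and their values -/

/-- The ring `𝒪_{X,O}` of germs at `O` of holomorphic functions. -/
def holGerms : Subring (Filter.Germ (𝓝 (0 : ℂ × ℂ)) ℂ) where
  carrier := {g | ∃ F : ℂ × ℂ → ℂ, AnalyticAt ℂ F 0 ∧ (F : Filter.Germ (𝓝 (0 : ℂ × ℂ)) ℂ) = g}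
  mul_mem' := by
    rintro _ _ ⟨F, hF, rfl⟩ ⟨G, hG, rfl⟩
    exact ⟨F * G, hF.mul hG, rfl⟩
  one_mem' := ⟨1, analyticAt_const, rfl⟩
  add_mem' := by
    rintro _ _ ⟨F, hF, rfl⟩ ⟨G, hG, rfl⟩
    exact ⟨F + G, hF.add hG, rfl⟩
  zero_mem' := ⟨0, analyticAt_const, rfl⟩
  neg_mem' := by
    rintro _ ⟨F, hF, rfl⟩
    exact ⟨-F, hF.neg, rfl⟩

/-- The value `v_p(g)`: the order of vanishing along `E_p` of the pull-back of `g`, which is the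
order at the point `p` of the pull-back of `g` to the surface on which `p` lies. -/
def value (p : Pt) (g : holGerms) : ℕ∞ :=
  ⨆ (n : ℕ) (_ : ∃ F : ℂ × ℂ → ℂ, (F : Filter.Germ (𝓝 (0 : ℂ × ℂ)) ℂ) = g ∧
    (fun z => F (p.chart z)) =O[𝓝 0] fun z => ‖z‖ ^ n), (n : ℕ∞)

/-- The exceptional part of the divisor of the pull-back of a nonzero germ. -/
def excDiv (g : holGerms) : K.Div := fun p => ((value p.1 g).toNat : ℤ)

/-- The germs `g = 0` and `h = 0` are smooth and transverse at `O`. -/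
def SmoothTransverse (g h : holGerms) : Prop :=
  ∃ F G : ℂ × ℂ → ℂ, AnalyticAt ℂ F 0 ∧ AnalyticAt ℂ G 0 ∧
    (F : Filter.Germ (𝓝 (0 : ℂ × ℂ)) ℂ) = g ∧ (G : Filter.Germ (𝓝 (0 : ℂ × ℂ)) ℂ) = h ∧
    F 0 = 0 ∧ G 0 = 0 ∧ LinearIndependent ℂ ![fderiv ℂ F 0, fderiv ℂ G 0]

/-! ### Maximal contact elements -/

/-- The dual graph of the exceptional divisor. -/
def dualGraph : SimpleGraph K.pts where
  Adj p q := p ≠ q ∧ K.inter (K.strict p) (K.strict q) ≠ 0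
  symm := ⟨fun p q h => ⟨h.1.symm, by
    have := h.2
    simpa only [inter, mul_comm] using this⟩⟩
  loopless := ⟨fun _ h => h.1 rfl⟩

/-- A vertex of the dual graph is a dead-end if the graph remains connected when it is removed. -/
def DeadEnd (p : K.pts) : Prop := (K.dualGraph.induce {p}ᶜ).Preconnected

/-- A choice of one germ for each dead-end. -/
abbrev ContactFamily : Type := {p : K.pts // K.DeadEnd p} → holGerms

/-- `f` is a set of maximal contact elements of `π`: `Div(π^* f_p)_exc = B_p` for each
dead-end `p`. -/
def IsMaximalContact (f : K.ContactFamily) : Prop := ∀ i, K.excDiv (f i) = K.branch i.1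

/-- A point is free if it is proximate to exactly one point. -/
def Free (q : K.pts) : Prop := ∃! p : K.pts, Pt.Proximate q p

/-- `p` is the last free point at which `D` has nonzero multiplicity. -/
def IsLastFree (D : K.Div) (p : K.pts) : Prop :=
  K.Free p ∧ K.mult D p ≠ 0 ∧
    ∀ r : K.pts, K.Free r → K.mult D r ≠ 0 → Pt.Precedes r.1 p.1

/-- The requirement on the maximal contact element `f_τ` and the exponent `n` selected for the
simple divisor `B_q`: if `p` is the last free point with `e_p(B_q) ≠ 0`, then
`e_p(f_τ) = 1`, `e_O(f_τ) ≤ e_O(B_q)` and `n = e_O(B_q) / e_O(f_τ)`. -/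
def Selectable (f : K.ContactFamily) (q : K.pts) (τ : {p : K.pts // K.DeadEnd p}) (n : ℕ) : Prop :=
  ∃ p, K.IsLastFree (K.branch q) p ∧ K.mult (K.excDiv (f τ)) p = 1 ∧
    K.mult (K.excDiv (f τ)) K.origin ≤ K.mult (K.branch q) K.origin ∧
    (n : ℤ) * K.mult (K.excDiv (f τ)) K.origin = K.mult (K.branch q) K.origin

/-! ### The algorithm, as a machine with a stack of pending recursive calls -/

/-- A pending step `(i)`, waiting for the result of a recursive call: its divisor `D^{(i)}`, the
index `q_j` of the simple divisor being treated, the indices still to be treated, the product of the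
generating sets obtained so far, and the selected power of a maximal contact element. -/
structure Frame : Type where
  D : K.Div
  q : K.pts
  todo : List K.pts
  acc : Set holGerms
  g : holGerms

/-- The states of the machine; ideals are represented by sets of generators. -/
inductive State : Type
  /-- Begin step `(i)` with `D^{(i)} = D`. -/
  | start (D : K.Div) (σ : List K.Frame)
  /-- Head of the loop over `j`. -/
  | loop (D : K.Div) (todo : List K.pts) (acc : Set holGerms) (σ : List K.Frame)
  /-- Inside the unloading procedure for `B_q + E_O`, with current divisor `C`. -/
  | unload (D : K.Div) (q : K.pts) (todo : List K.pts) (acc : Set holGerms) (C : K.Div)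
      (σ : List K.Frame)
  /-- The unloading procedure has returned `C`; a maximal contact element has to be selected. -/
  | select (D : K.Div) (q : K.pts) (todo : List K.pts) (acc : Set holGerms) (C : K.Div)
      (σ : List K.Frame)
  /-- Return the generating set `G` to the caller (or as the result, if the stack is empty). -/
  | ret (G : Set holGerms) (σ : List K.Frame)

/-- One elementary step of the algorithm, with fixed maximal contact elements `f`. -/
inductive Step (f : K.ContactFamily) : K.State → K.State → Prop
  /-- Decompose `D` into simple divisors: list the `q` with `ρ_q(D) > 0`. -/
  | decompose (D : K.Div) (σ : List K.Frame) (todo : List K.pts) :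
      todo.Nodup → (∀ q, q ∈ todo ↔ 0 < K.excess D q) →
      Step f (.start D σ) (.loop D todo {1} σ)
  /-- If `B_q = B_O`, use two smooth transverse maximal contact elements. -/
  | maximalIdeal (D : K.Div) (q : K.pts) (todo : List K.pts) (acc : Set holGerms)
      (σ : List K.Frame) (i₀ i₁ : {p : K.pts // K.DeadEnd p}) :
      K.branch q = K.branch K.origin → SmoothTransverse (f i₀) (f i₁) →
      Step f (.loop D (q :: todo) acc σ)
        (.loop D todo (acc * {f i₀, f i₁} ^ (K.excess D q).toNat) σ)
  /-- If `B_q ≠ B_O`, perform unloading on `B_q + E_O`. -/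
  | enterUnload (D : K.Div) (q : K.pts) (todo : List K.pts) (acc : Set holGerms)
      (σ : List K.Frame) :
      K.branch q ≠ K.branch K.origin →
      Step f (.loop D (q :: todo) acc σ)
        (.unload D q todo acc (K.branch q + K.strict K.origin) σ)
  /-- A pass of unloading after which the divisor is not yet antinef. -/
  | unloadAgain (D : K.Div) (q : K.pts) (todo : List K.pts) (acc : Set holGerms) (C : K.Div)
      (σ : List K.Frame) :
      ¬ K.Antinef (K.unloadPass C) →
      Step f (.unload D q todo acc C σ) (.unload D q todo acc (K.unloadPass C) σ)
  /-- A pass of unloading after which the divisor is antinef. -/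
  | unloadStop (D : K.Div) (q : K.pts) (todo : List K.pts) (acc : Set holGerms) (C : K.Div)
      (σ : List K.Frame) :
      K.Antinef (K.unloadPass C) →
      Step f (.unload D q todo acc C σ) (.select D q todo acc (K.unloadPass C) σ)
  /-- Select a power of a maximal contact element and call the next step recursively. -/
  | selectCall (D : K.Div) (q : K.pts) (todo : List K.pts) (acc : Set holGerms) (C : K.Div)
      (σ : List K.Frame) (τ : {p : K.pts // K.DeadEnd p}) (n : ℕ) :
      K.Selectable f q τ n →
      Step f (.select D q todo acc C σ) (.start C (⟨D, q, todo, acc, f τ ^ n⟩ :: σ))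
  /-- Return from a recursive call: the selected power together with the returned generators
  generate `H_{B_q}`; multiply by the `ρ_q(D)`-th power. -/
  | resume (G : Set holGerms) (F : K.Frame) (σ : List K.Frame) :
      Step f (.ret G (F :: σ))
        (.loop F.D F.todo (F.acc * (insert F.g G) ^ (K.excess F.D F.q).toNat) σ)
  /-- All simple divisors are treated: keep the generators `h` of the product for which `π^* h`
  is not a section of `𝒪(-D - Ē_O)`. -/
  | finish (D : K.Div) (acc : Set holGerms) (σ : List K.Frame) :
      Step f (.loop D [] acc σ)
        (.ret {h ∈ acc | ¬ ∀ p : K.pts,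
          (((D + K.total K.origin) p).toNat : ℕ∞) ≤ value p.1 h} σ)

/-- `D^{(i+1)} = C` can follow `D^{(i)} = D` in the algorithm: `C` is the result of unloading
`B_q + E_O` for some simple summand `B_q ≠ B_O` of `D`. -/
def NextDivisor (D C : K.Div) : Prop :=
  ∃ q, 0 < K.excess D q ∧ K.branch q ≠ K.branch K.origin ∧
    K.Unloads (K.branch q + K.strict K.origin) C

end Cluster

end PlaneCluster

end

/-!
Write `v`, `e`, `ρ` for the values, multiplicities and excesses of a divisor, and `P` for the
proximity matrix, so that `e = P v` and `ρ = Pᵀ e`. Since `P` is unipotent with nonpositive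
off-diagonal entries, `ρ ≥ 0` implies `e ≥ 0`, and `e ≥ 0` implies `v ≥ 0`.

Distinct exceptional curves meet nonnegatively (`inter_strict_nonneg`), hence a pass of unloading
never exceeds an antinef divisor above the given one (`unloadPass_le`). As multiples of `B_O` are
antinef and arbitrarily large, unloading stops, and what it returns is the antinef closure.

Let `C` be the antinef closure of `B_q + E_O`, where `q ≠ O`. The value of `C` exceeds that of `B_q`
at some point to which `q` is proximate (`exists_proximate_branch_lt`). This strict inequality at
least makes up for the multiplicity `e_q(B_q) = 1`, so annihilating all multiplicities of `C`
outside `Supp(B_q) \ {q}` yields an antinef divisor which is still at least `B_q + E_O`. By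
minimality this divisor is `C` (`mult_antinefClosure_eq_zero`).

So the support shrinks strictly in each recursive call, which bounds the chains of divisors
(`chain_length_le`). For the executions, induction on the size of the support gives a
bound that depends on the cluster and that size only (`exists_stepsLE_start`): a step treats at most
`|K|` simple divisors, and for each of them unloading takes a number of passes determined by `q`.
-/

namespace PlaneCluster

/-! ### Proximity of infinitely near points -/

namespace Pt

theorem not_proximate_self (p : Pt) : ¬ Proximate p p := fun h => lt_irrefl _ h.depth_lt

theorem proximate_near (p : Pt) (t : OnePoint ℂ) : Proximate (near p t) p := by
  cases t with
  | infty => exact Or.inr rfl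
  | coe c => exact Or.inl rfl

theorem axisU_ne_axisV (s p : Pt) (hU : axisU s = some p) : axisV s ≠ some p := by
  intro hV
  cases s with
  | O => simp [axisU] at hU
  | near r t =>
    cases t with
    | infty =>
      have h1 : axisU r = some p := hU
      have h2 : r = p := Option.some.inj hV
      subst h2
      exact lt_irrefl _ ((axis_depth r).1 r h1)
    | coe c =>
      have h2 : r = p := Option.some.inj hU
      have h1 : (if c = 0 then axisV r else none) = some p := hV
      subst h2
      split_ifs at h1
      exact lt_irrefl _ ((axis_depth r).2 r h1)

open scoped Classical in
/-- A point proximate to two distinct points is their satellite: it lies on the exceptional curve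
of the later one, `p`, at its intersection with the strict transform of the exceptional curve of
the earlier one, `r`. In particular it is unique and `p` is proximate to `r`. -/
theorem eq_near_of_proximate {s p r : Pt} (hp : Proximate s p) (hr : Proximate s r) (hne : p ≠ r)
    (hd : r.depth ≤ p.depth) :
    Proximate p r ∧ s = near p (if axisU p = some r then OnePoint.infty else ((0 : ℂ) : OnePoint ℂ)) := by
  cases s with
  | O => rcases hp with h | h <;> simp [axisU, axisV] at h
  | near x t =>
    cases t with
    | infty =>
      have key : ∀ y, Proximate (near x OnePoint.infty) y → axisU x = some y ∨ x = y := by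
        rintro y (h | h)
        · exact Or.inl h
        · exact Or.inr (Option.some.inj h)
      rcases key p hp with h1 | rfl <;> rcases key r hr with h2 | rfl
      · exact absurd (Option.some.inj (h1.symm.trans h2)) hne
      · exact absurd ((axis_depth _).1 _ h1) (not_lt.mpr hd)
      · exact ⟨Or.inl h2, by rw [if_pos h2]⟩
      · exact absurd rfl hne
    | coe c =>
      have key : ∀ y, Proximate (near x (c : OnePoint ℂ)) y → x = y ∨ (c = 0 ∧ axisV x = some y) := by
        rintro y (h | h)
        · exact Or.inl (Option.some.inj h)
        · have h' : (if c = 0 then axisV x else none) = some y := h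
          split_ifs at h' with hc
          exact Or.inr ⟨hc, h'⟩
      rcases key p hp with rfl | h1 <;> rcases key r hr with rfl | h2
      · exact absurd rfl hne
      · refine ⟨Or.inr h2.2, ?_⟩
        rw [if_neg fun h => axisU_ne_axisV _ _ h h2.2, h2.1]
      · exact absurd ((axis_depth _).2 _ h1.2) (not_lt.mpr hd)
      · exact absurd (Option.some.inj (h1.2.symm.trans h2.2)) hne

end Pt

namespace Cluster

variable (K : Cluster)

/-! ### Multiplicities, values and excesses -/

/-- Induction from the origin upwards, along proximity. -/
theorem depth_induction {Q : K.pts → Prop}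
    (h : ∀ p : K.pts, (∀ r : K.pts, Pt.Proximate p r → Q r) → Q p) (p : K.pts) : Q p := by
  have hw : WellFounded fun a b : K.pts => Pt.depth a.1 < Pt.depth b.1 :=
    InvImage.wf (fun a : K.pts => Pt.depth a.1) Nat.lt_wfRel.wf
  exact hw.induction p fun p ih => h p fun r hr => ih r hr.depth_lt

/-- Induction from the maximal points downwards, along proximity. -/
theorem reverse_depth_induction {Q : K.pts → Prop}
    (h : ∀ p : K.pts, (∀ r : K.pts, Pt.Proximate r p → Q r) → Q p) (p : K.pts) : Q p := by
  have : IsTrans K.pts fun a b => Pt.depth b.1 < Pt.depth a.1 := ⟨fun _ _ _ h h' => h'.trans h⟩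
  have : Std.Irrefl fun a b : K.pts => Pt.depth b.1 < Pt.depth a.1 := ⟨fun _ => lt_irrefl _⟩
  have hw : WellFounded fun a b : K.pts => Pt.depth b.1 < Pt.depth a.1 :=
    Finite.wellFounded_of_trans_of_irrefl _
  exact hw.induction p fun p ih => h p fun r hr => ih r hr.depth_lt

theorem proximity_self (p : K.pts) : K.proximity p p = 1 := by simp [proximity]

open scoped Classical in
theorem proximity_of_ne {q p : K.pts} (h : q ≠ p) :
    K.proximity q p = if Pt.Proximate q p then -1 else 0 := by simp [proximity, h]

open scoped Classical in
theorem proximity_eq (q p : K.pts) : K.proximity q p =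
    (if q = p then 1 else 0) - if Pt.Proximate q p then 1 else 0 := by
  by_cases h : q = p
  · subst h
    simp [proximity, Pt.not_proximate_self]
  · rw [proximity_of_ne K h]
    split_ifs <;> simp

open scoped Classical in
/-- The relation `e = P v`, solved for the value. -/
theorem value_eq (D : K.Div) (q : K.pts) :
    D q = K.mult D q + ∑ p : K.pts, if Pt.Proximate q p then D p else 0 := by
  simp [mult, Matrix.mulVec, dotProduct, proximity_eq, sub_mul, Finset.sum_sub_distrib]

theorem excess_eq_sum (D : K.Div) (p : K.pts) :
    K.excess D p = ∑ q, K.mult D q * K.proximity q p := by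
  simp [excess, inter, strict, mult]

open scoped Classical in
/-- The relation `ρ = Pᵀ e`, solved for the multiplicity. -/
theorem mult_eq (D : K.Div) (p : K.pts) :
    K.mult D p = K.excess D p + ∑ q : K.pts, if Pt.Proximate q p then K.mult D q else 0 := by
  simp [excess_eq_sum, proximity_eq, mul_sub, Finset.sum_sub_distrib]

theorem mult_sub (D C : K.Div) (p : K.pts) : K.mult (D - C) p = K.mult D p - K.mult C p := by
  simp [mult, Matrix.mulVec_sub]

theorem excess_sub (D C : K.Div) (p : K.pts) :
    K.excess (D - C) p = K.excess D p - K.excess C p := by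
  simp [excess_eq_sum, mult_sub, sub_mul, Finset.sum_sub_distrib]

theorem exists_mult_eq (e : K.pts → ℤ) : ∃ D : K.Div, K.mult D = e := by
  refine ⟨K.proximity⁻¹.mulVec e, ?_⟩
  rw [mult, Matrix.mulVec_mulVec, Matrix.mul_nonsing_inv _ (by simp [det_proximity]),
    Matrix.one_mulVec]

theorem mult_nonneg {D : K.Div} (h : ∀ p, 0 ≤ K.excess D p) : ∀ p, 0 ≤ K.mult D p := by
  classical
  refine K.reverse_depth_induction fun p ih => ?_
  rw [mult_eq]
  refine add_nonneg (h p) (Finset.sum_nonneg fun r _ => ?_)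
  split_ifs with hr
  exacts [ih r hr, le_rfl]

theorem nonneg_of_mult_nonneg {D : K.Div} (h : ∀ p, 0 ≤ K.mult D p) : ∀ p, 0 ≤ D p := by
  classical
  refine K.depth_induction fun p ih => ?_
  rw [K.value_eq D p]
  refine add_nonneg (h p) (Finset.sum_nonneg fun r _ => ?_)
  split_ifs with hr
  exacts [ih r hr, le_rfl]

theorem antinef_of_excess_nonneg {D : K.Div} (h : ∀ p, 0 ≤ K.excess D p) : K.Antinef D :=
  ⟨K.nonneg_of_mult_nonneg (K.mult_nonneg h), h⟩

theorem mult_le_of_proximate {D : K.Div} (h : ∀ p, 0 ≤ K.excess D p) {q p : K.pts}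
    (hqp : Pt.Proximate q p) : K.mult D q ≤ K.mult D p := by
  classical
  rw [K.mult_eq D p]
  have := Finset.single_le_sum (f := fun r : K.pts => if Pt.Proximate r p then K.mult D r else 0)
    (fun r _ => by
      split_ifs
      exacts [K.mult_nonneg h r, le_rfl]) (Finset.mem_univ q)
  simp only [hqp, if_true] at this
  linarith [h p]

theorem value_le_of_proximate {D : K.Div} (h : ∀ p, 0 ≤ K.mult D p) {q p : K.pts}
    (hqp : Pt.Proximate q p) : D p ≤ D q := by
  classical
  rw [K.value_eq D q]
  have := Finset.single_le_sum (f := fun r : K.pts => if Pt.Proximate q r then D r else 0)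
    (fun r _ => by
      split_ifs
      exacts [K.nonneg_of_mult_nonneg h r, le_rfl]) (Finset.mem_univ p)
  simp only [hqp, if_true] at this
  linarith [h q]

/-- A property inherited by the points to which a point is proximate descends to the origin: every
point of the cluster other than the origin is proximate to the point it was obtained from. -/
theorem ancestor_induction {Q : K.pts → Prop}
    (h : ∀ q p : K.pts, Pt.Proximate q p → Q q → Q p) (q : K.pts) (hq : Q q) : Q K.origin := by
  obtain ⟨x, hx⟩ := q
  induction x with
  | O => exact hq
  | near p t ih =>
    exact ih (K.closed p t hx) (h _ ⟨p, K.closed p t hx⟩ (Pt.proximate_near p t) hq)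

theorem value_origin_le {D : K.Div} (h : ∀ p, 0 ≤ K.mult D p) (q : K.pts) :
    D K.origin ≤ D q :=
  K.ancestor_induction (Q := fun p => D p ≤ D q)
    (fun _ _ hrp hr => (K.value_le_of_proximate h hrp).trans hr) q le_rfl

/-! ### Simple divisors -/

theorem excess_branch_nonneg (q p : K.pts) : 0 ≤ K.excess (K.branch q) p := by
  rw [excess_branch]
  split_ifs <;> simp

theorem antinef_branch (q : K.pts) : K.Antinef (K.branch q) :=
  K.antinef_of_excess_nonneg (K.excess_branch_nonneg q)

theorem mult_branch_eq_zero (q p : K.pts) (hpq : p ≠ q) (hd : q.1.depth ≤ p.1.depth) :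
    K.mult (K.branch q) p = 0 := by
  classical
  revert hpq hd
  revert p
  refine K.reverse_depth_induction fun p ih hpq hd => ?_
  rw [mult_eq, excess_branch, if_neg hpq, zero_add]
  refine Finset.sum_eq_zero fun r _ => ?_
  split_ifs with hr
  · have hlt := hr.depth_lt
    refine ih r hr ?_ (by omega)
    rintro rfl
    omega
  · rfl

theorem mult_branch_self (q : K.pts) : K.mult (K.branch q) q = 1 := by
  classical
  rw [mult_eq, excess_branch, if_pos rfl, Finset.sum_eq_zero, add_zero]
  intro r _
  split_ifs with hr
  · refine K.mult_branch_eq_zero q r ?_ hr.depth_lt.le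
    rintro rfl
    exact Pt.not_proximate_self _ hr
  · rfl

theorem mult_branch_ne_zero_of_proximate {q r p : K.pts} (hrp : Pt.Proximate r p)
    (hr : K.mult (K.branch q) r ≠ 0) : K.mult (K.branch q) p ≠ 0 := by
  have h0 := K.excess_branch_nonneg q
  have h1 := K.mult_nonneg h0 r
  have h2 := K.mult_le_of_proximate h0 hrp
  omega

theorem mult_branch_origin_ne_zero (q : K.pts) : K.mult (K.branch q) K.origin ≠ 0 :=
  K.ancestor_induction (Q := fun p => K.mult (K.branch q) p ≠ 0)
    (fun _ _ h => K.mult_branch_ne_zero_of_proximate h) q (by simp [mult_branch_self])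

/-- A simple divisor `B_q` with `ρ_q(D) > 0` is a summand of the antinef divisor `D`. -/
theorem totalSupport_branch_subset {D : K.Div} (hD : K.Antinef D) {q : K.pts}
    (hq : 0 < K.excess D q) : K.totalSupport (K.branch q) ⊆ K.totalSupport D := by
  intro p hp
  have h0 := K.mult_nonneg (K.excess_branch_nonneg q) p
  have h1 : ∀ r, 0 ≤ K.excess (D - K.branch q) r := by
    intro r
    rw [excess_sub, excess_branch]
    split_ifs with h
    · subst h
      omega
    · simpa using hD.2 r
  have h2 := K.mult_nonneg h1 p
  rw [mult_sub] at h2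
  simp only [totalSupport, Set.mem_ofPred_eq] at hp ⊢
  omega

/-! ### Unloading computes the antinef closure -/

theorem neg_inter_strict (p r : K.pts) :
    -K.inter (K.strict p) (K.strict r) = ∑ s, K.proximity s p * K.proximity s r := by
  simp [inter, strict, mult]

theorem excess_eq_sum_inter (D : K.Div) (p : K.pts) :
    K.excess D p = ∑ r, -K.inter (K.strict p) (K.strict r) * D r := by
  simp only [excess_eq_sum, neg_inter_strict, mult, Matrix.mulVec, dotProduct, Finset.sum_mul]
  rw [Finset.sum_comm]
  exact Finset.sum_congr rfl fun _ _ => Finset.sum_congr rfl fun _ _ => by ring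

theorem inter_strict_self_neg (p : K.pts) : K.inter (K.strict p) (K.strict p) < 0 := by
  have h := Finset.single_le_sum (f := fun s => K.proximity s p * K.proximity s p)
    (fun s _ => mul_self_nonneg _) (Finset.mem_univ p)
  rw [← neg_inter_strict] at h
  simp only [proximity_self] at h
  omega

/-- Distinct exceptional curves meet nonnegatively: when `p → r`, the contribution `-1` of `p` to
`-E_p · E_r` compensates the only point of the cluster that is proximate to both. -/
theorem inter_strict_nonneg {p r : K.pts} (h : p ≠ r) :
    0 ≤ K.inter (K.strict p) (K.strict r) := by
  classical
  wlog hd : r.1.depth ≤ p.1.depth generalizing p r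
  · have := this h.symm (by omega)
    simpa only [inter, mul_comm] using this
  have hrp : ¬ Pt.Proximate r p := fun h' => absurd h'.depth_lt (not_lt.mpr hd)
  have hne : p.1 ≠ r.1 := fun h' => h (Subtype.ext h')
  suffices hs : ∑ s, K.proximity s p * K.proximity s r ≤ 0 by
    rw [← neg_inter_strict] at hs
    omega
  by_cases hpr : Pt.Proximate p r
  · set s₀ : Pt := Pt.near p (if Pt.axisU p = some r.1 then OnePoint.infty else ((0 : ℂ) : OnePoint ℂ))
    have hle : ∀ s : K.pts, K.proximity s p * K.proximity s r ≤
        (if s.1 = s₀ then 1 else 0) - if s = p then 1 else 0 := by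
      intro s
      by_cases h1 : s = p
      · subst h1
        rw [proximity_self, proximity_of_ne K h, if_pos hpr, if_pos rfl]
        split_ifs <;> norm_num
      · rw [proximity_of_ne K h1, if_neg h1]
        by_cases h2 : s = r
        · subst h2
          rw [if_neg hrp]
          split_ifs <;> norm_num
        · rw [proximity_of_ne K h2]
          by_cases h3 : Pt.Proximate s p <;> by_cases h4 : Pt.Proximate s r
          · rw [if_pos (Pt.eq_near_of_proximate h3 h4 hne hd).2]
            simp [h3, h4]
          all_goals
            simp only [h3, h4, if_true, if_false]
            split_ifs <;> norm_num
    refine (Finset.sum_le_sum fun s _ => hle s).trans ?_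
    rw [Finset.sum_sub_distrib, Finset.sum_ite_eq' Finset.univ p]
    have hcard : (∑ s : K.pts, if s.1 = s₀ then (1 : ℤ) else 0) ≤ 1 := by
      rw [Finset.sum_boole]
      have : (Finset.univ.filter fun s : K.pts => s.1 = s₀).card ≤ 1 := by
        refine Finset.card_le_one.mpr fun a ha b hb => Subtype.ext ?_
        exact (Finset.mem_filter.mp ha).2.trans (Finset.mem_filter.mp hb).2.symm
      exact_mod_cast this
    simpa using hcard
  · refine Finset.sum_nonpos fun s _ => ?_
    by_cases h1 : s = p
    · subst h1
      rw [proximity_self, proximity_of_ne K h, if_neg hpr, mul_zero]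
    · by_cases h2 : s = r
      · subst h2
        rw [proximity_of_ne K h1, if_neg hrp, zero_mul]
      · rw [proximity_of_ne K h1, proximity_of_ne K h2]
        by_cases h3 : Pt.Proximate s p <;> by_cases h4 : Pt.Proximate s r
        · exact absurd (Pt.eq_near_of_proximate h3 h4 hne hd).1 hpr
        all_goals simp [h3, h4]

theorem le_unloadPass (D : K.Div) : D ≤ K.unloadPass D := by
  intro p
  simp only [unloadPass]
  split_ifs with h
  · have h1 : (0 : ℚ) ≤ (K.excess D p : ℚ) / (K.inter (K.strict p) (K.strict p) : ℚ) :=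
      div_nonneg_of_nonpos (by exact_mod_cast h.le)
        (by exact_mod_cast (K.inter_strict_self_neg p).le)
    have := Int.ceil_nonneg h1
    omega
  · exact le_rfl

theorem unloadPass_le {D Z : K.Div} (hZ : K.Antinef Z) (h : D ≤ Z) : K.unloadPass D ≤ Z := by
  classical
  intro p
  simp only [unloadPass]
  split_ifs with hp
  · have hneg := K.inter_strict_self_neg p
    have h1 : K.excess (Z - D) p ≤
        -K.inter (K.strict p) (K.strict p) * (Z p - D p) := by
      rw [excess_eq_sum_inter, ← Finset.add_sum_erase _ _ (Finset.mem_univ p)]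
      have : ∑ r ∈ Finset.univ.erase p,
          -K.inter (K.strict p) (K.strict r) * (Z - D) r ≤ 0 := by
        refine Finset.sum_nonpos fun r hr => ?_
        have h2 := K.inter_strict_nonneg (Finset.ne_of_mem_erase hr).symm
        have h3 : 0 ≤ (Z - D) r := sub_nonneg.mpr (h r)
        nlinarith
      simp only [Pi.sub_apply] at this ⊢
      linarith
    rw [excess_sub] at h1
    have h2 := hZ.2 p
    have h3 : ⌈(K.excess D p : ℚ) / (K.inter (K.strict p) (K.strict p) : ℚ)⌉ ≤ Z p - D p := by
      rw [Int.ceil_le, div_le_iff_of_neg (by exact_mod_cast hneg)]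
      have : (Z p - D p) * K.inter (K.strict p) (K.strict p) ≤ K.excess D p := by linarith
      exact_mod_cast this
    omega
  · exact h p

theorem isAntinefClosure_unloadPass {D C : K.Div} :
    K.IsAntinefClosure (K.unloadPass D) C ↔ K.IsAntinefClosure D C := by
  have : {Z | K.Antinef Z ∧ K.unloadPass D ≤ Z} = {Z | K.Antinef Z ∧ D ≤ Z} :=
    Set.ext fun Z => and_congr_right fun hZ =>
      ⟨fun h => (K.le_unloadPass D).trans h, fun h => K.unloadPass_le hZ h⟩
  rw [IsAntinefClosure, IsAntinefClosure, this]

variable {K} in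
theorem Unloads.isAntinefClosure {D C : K.Div} (h : K.Unloads D C) : K.IsAntinefClosure D C := by
  induction h with
  | final D h => exact K.isAntinefClosure_unloadPass.mp ⟨⟨h, le_rfl⟩, fun _ hZ => hZ.2⟩
  | again D C _ _ ih => exact K.isAntinefClosure_unloadPass.mp ih

theorem exists_antinef_ge (D : K.Div) : ∃ Z, K.Antinef Z ∧ D ≤ Z := by
  have hB := K.antinef_branch K.origin
  have hpos : ∀ p, 1 ≤ K.branch K.origin p := by
    intro p
    have h1 := K.value_origin_le (K.mult_nonneg hB.2) p
    have h2 := K.value_eq (K.branch K.origin) K.origin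
    have h3 : ∀ r : K.pts, ¬ Pt.Proximate K.origin r := fun r hr => Nat.not_lt_zero _ hr.depth_lt
    rw [mult_branch_self] at h2
    simp only [h3, if_false, Finset.sum_const_zero] at h2
    omega
  set n : ℕ := ∑ p, (D p).natAbs
  refine ⟨n • K.branch K.origin, K.antinef_of_excess_nonneg fun p => ?_, fun p => ?_⟩
  · rw [excess_eq_sum]
    have : K.mult (n • K.branch K.origin) = n • K.mult (K.branch K.origin) :=
      Matrix.mulVec_smul _ _ _
    simp only [this, Pi.smul_apply, smul_mul_assoc]
    rw [← Finset.smul_sum, ← excess_eq_sum]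
    exact nsmul_nonneg (hB.2 p) n
  · have h1 : (D p).natAbs ≤ n :=
      Finset.single_le_sum (f := fun p => (D p).natAbs) (fun _ _ => Nat.zero_le _)
        (Finset.mem_univ p)
    have h2 := hpos p
    simp only [Pi.smul_apply, nsmul_eq_mul]
    have h3 : D p ≤ n := by omega
    nlinarith

theorem exists_unloads (D : K.Div) : ∃ C, K.Unloads D C := by
  obtain ⟨Z, hZ, hDZ⟩ := K.exists_antinef_ge D
  -- the passes increase and stay below `Z`
  induction hm : (∑ p, (Z p - D p)).toNat using Nat.strong_induction_on generalizing D with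
  | _ m ih =>
    by_cases hC : K.Antinef (K.unloadPass D)
    · exact ⟨_, .final D hC⟩
    · have hne : D ≠ K.unloadPass D := by
        intro heq
        refine hC (K.antinef_of_excess_nonneg fun p => ?_)
        rw [← heq]
        by_contra! hp
        have h1 := congrFun heq p
        simp only [unloadPass, if_pos hp] at h1
        have h2 : (0 : ℚ) < (K.excess D p : ℚ) / (K.inter (K.strict p) (K.strict p) : ℚ) :=
          div_pos_of_neg_of_neg (by exact_mod_cast hp)
            (by exact_mod_cast K.inter_strict_self_neg p)
        have := Int.ceil_pos.mpr h2
        omega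
      have hlt := lt_of_le_of_ne (K.le_unloadPass D) hne
      have hle := K.unloadPass_le hZ hDZ
      obtain ⟨hle', p, hp⟩ := Pi.lt_def.mp hlt
      have h1 : ∑ p, (Z p - K.unloadPass D p) < ∑ p, (Z p - D p) :=
        Finset.sum_lt_sum (fun r _ => sub_le_sub_left (hle' r) _)
          ⟨p, Finset.mem_univ p, sub_lt_sub_left hp _⟩
      have h2 : 0 ≤ ∑ p, (Z p - K.unloadPass D p) :=
        Finset.sum_nonneg fun r _ => sub_nonneg.mpr (hle r)
      obtain ⟨C, h⟩ := ih _ (by omega) _ hle rfl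
      exact ⟨C, .again D C hC h⟩

/-! ### The support of the antinef closure -/

/-- An antinef divisor above `B_q` whose value at the origin is larger also has a larger value at
some point to which `q` is proximate. Otherwise the difference `W` would satisfy
`e_q(W) = v_q(W) ≥ 0`; as `ρ_p(W) ≥ 0` for `p ≠ q`, all multiplicities of `W` would be nonnegative,
and `W` would be positive everywhere. -/
theorem exists_proximate_branch_lt {q : K.pts} (hq : q ≠ K.origin) {Z : K.Div} (hZ : K.Antinef Z)
    (hle : K.branch q ≤ Z) (hO : K.branch q K.origin < Z K.origin) :
    ∃ r : K.pts, Pt.Proximate q r ∧ K.branch q r < Z r := by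
  classical
  by_contra! hcon
  have hzero : ∀ r : K.pts, Pt.Proximate q r → (Z - K.branch q) r = 0 := fun r hr =>
    sub_eq_zero.mpr (le_antisymm (hcon r hr) (hle r))
  have hmult : ∀ p, 0 ≤ K.mult (Z - K.branch q) p := by
    refine K.reverse_depth_induction fun p ih => ?_
    by_cases hpq : p = q
    · subst hpq
      have h1 := K.value_eq (Z - K.branch p) p
      rw [Finset.sum_eq_zero, add_zero] at h1
      · rw [← h1]
        exact sub_nonneg.mpr (hle p)
      · intro r _
        split_ifs with hr
        exacts [hzero r hr, rfl]
    · rw [mult_eq, excess_sub, excess_branch, if_neg hpq, sub_zero]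
      refine add_nonneg (hZ.2 p) (Finset.sum_nonneg fun r _ => ?_)
      split_ifs with hr
      exacts [ih r hr, le_rfl]
  have hpos : ∀ p, 0 < (Z - K.branch q) p := fun p =>
    (sub_pos.mpr hO).trans_le (K.value_origin_le hmult p)
  obtain ⟨x, hx⟩ := q
  cases x with
  | O => exact hq rfl
  | near p t =>
    have h := hzero ⟨p, K.closed p t hx⟩ (Pt.proximate_near p t)
    exact absurd (hpos ⟨p, K.closed p t hx⟩) (by rw [h]; exact lt_irrefl _)

/-- Cutting off the multiplicities of the closure outside `Supp(B_q) \ {q}` leaves an antinef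
divisor that is still at least `B_q + E_O`; by minimality nothing is cut off. -/
theorem mult_antinefClosure_eq_zero {q : K.pts} (hq : q ≠ K.origin) {C : K.Div}
    (hC : K.IsAntinefClosure (K.branch q + K.strict K.origin) C) {p : K.pts}
    (hp : ¬ (K.mult (K.branch q) p ≠ 0 ∧ p ≠ q)) : K.mult C p = 0 := by
  classical
  obtain ⟨⟨hA, hge⟩, hmin⟩ := hC
  have hCm := K.mult_nonneg hA.2
  have hstrict : ∀ p, 0 ≤ K.strict K.origin p := fun p => by
    rw [strict, Pi.single_apply]
    split_ifs <;> simp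
  have hBC : K.branch q ≤ C := fun p =>
    (le_add_of_nonneg_right (hstrict p)).trans (hge p)
  set S : K.pts → Prop := fun p => K.mult (K.branch q) p ≠ 0 ∧ p ≠ q
  have hS : ∀ r p : K.pts, Pt.Proximate r p → K.mult (K.branch q) r ≠ 0 → S p := by
    refine fun r p hrp hr => ⟨K.mult_branch_ne_zero_of_proximate hrp hr, ?_⟩
    rintro rfl
    refine hr (K.mult_branch_eq_zero p r ?_ hrp.depth_lt.le)
    rintro rfl
    exact Pt.not_proximate_self _ hrp
  have hSO : S K.origin := ⟨K.mult_branch_origin_ne_zero q, hq.symm⟩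
  obtain ⟨T, hT⟩ := K.exists_mult_eq fun p => if S p then K.mult C p else 0
  have hTm : ∀ p, K.mult T p = if S p then K.mult C p else 0 := congrFun hT
  have hTle : ∀ p, K.mult T p ≤ K.mult C p := fun p => by
    rw [hTm]
    split_ifs
    exacts [le_rfl, hCm p]
  have hTA : K.Antinef T := by
    refine K.antinef_of_excess_nonneg fun p => ?_
    have h1 := K.mult_eq T p
    by_cases hSp : S p
    · have h2 := K.mult_eq C p
      have h3 : (∑ r : K.pts, if Pt.Proximate r p then K.mult T r else 0) ≤
          ∑ r : K.pts, if Pt.Proximate r p then K.mult C r else 0 :=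
        Finset.sum_le_sum fun r _ => by
          split_ifs
          exacts [hTle r, le_rfl]
      rw [hTm, if_pos hSp] at h1
      linarith [hA.2 p]
    · rw [Finset.sum_eq_zero, hTm, if_neg hSp] at h1
      · linarith
      · intro r _
        split_ifs with hr
        · rw [hTm, if_neg fun h => hSp (hS r p hr h.1)]
        · rfl
  have hTC : ∀ p : K.pts, S p → T p = C p := by
    refine K.depth_induction fun p ih hSp => ?_
    rw [K.value_eq T p, K.value_eq C p, hTm, if_pos hSp]
    congr 1
    refine Finset.sum_congr rfl fun r _ => ?_
    split_ifs with hr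
    exacts [ih r hr (hS p r hr hSp.1), rfl]
  have hTge : ∀ p, (K.branch q + K.strict K.origin) p ≤ T p := by
    refine K.depth_induction fun p ih => ?_
    by_cases hSp : S p
    · rw [hTC p hSp]
      exact hge p
    have hpO : p ≠ K.origin := fun h => hSp (h ▸ hSO)
    have hB : (K.branch q + K.strict K.origin) p = K.branch q p := by
      simp [strict, hpO]
    have hle : ∀ r ∈ (Finset.univ : Finset K.pts), (if Pt.Proximate p r then K.branch q r else 0) ≤
        if Pt.Proximate p r then T r else 0 := fun r _ => by
      split_ifs with hr
      exacts [(le_add_of_nonneg_right (hstrict r)).trans (ih r hr), le_rfl]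
    rw [hB, K.value_eq (K.branch q) p, K.value_eq T p, hTm, if_neg hSp]
    by_cases hpq : p = q
    · subst hpq
      rw [mult_branch_self]
      have hO : K.branch p K.origin < C K.origin := by
        have := hge K.origin
        simp only [Pi.add_apply, strict, Pi.single_eq_same] at this
        omega
      obtain ⟨r, hr, hlt⟩ := K.exists_proximate_branch_lt hq hA hBC hO
      have := Finset.sum_lt_sum hle ⟨r, Finset.mem_univ r, by
        rw [if_pos hr, if_pos hr, hTC r (hS p r hr (by simp [mult_branch_self]))]
        exact hlt⟩
      omega
    · have h0 : K.mult (K.branch q) p = 0 := by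
        by_contra h
        exact hSp ⟨h, hpq⟩
      rw [h0]
      exact add_le_add_right (Finset.sum_le_sum hle) 0
  have hCT : T = C := le_antisymm
    (fun p => sub_nonneg.mp (K.nonneg_of_mult_nonneg (D := C - T)
      (fun r => by rw [mult_sub]; exact sub_nonneg.mpr (hTle r)) p))
    (hmin ⟨hTA, hTge⟩)
  rw [← hCT, hTm, if_neg hp]

theorem totalSupport_antinefClosure_ssubset {q : K.pts} (hq : q ≠ K.origin) {C : K.Div}
    (hC : K.IsAntinefClosure (K.branch q + K.strict K.origin) C) :
    K.totalSupport C ⊂ K.totalSupport (K.branch q) := by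
  refine (Set.ssubset_iff_of_subset fun p hp => ?_).mpr ⟨q, ?_, fun h => h ?_⟩
  · by_contra h
    exact hp (K.mult_antinefClosure_eq_zero hq hC fun h' => h h'.1)
  · simp [totalSupport, mult_branch_self]
  · exact K.mult_antinefClosure_eq_zero hq hC fun h' => h'.2 rfl

/-! ### Termination of the algorithm -/

variable {K} in
theorem NextDivisor.antinef {D C : K.Div} (h : K.NextDivisor D C) : K.Antinef C := by
  obtain ⟨q, -, -, hu⟩ := h
  exact hu.isAntinefClosure.1.1

variable {K} in
theorem NextDivisor.ncard_lt {D C : K.Div} (h : K.NextDivisor D C) (hD : K.Antinef D) :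
    (K.totalSupport C).ncard < (K.totalSupport D).ncard := by
  obtain ⟨q, hq, hne, hu⟩ := h
  have hqO : q ≠ K.origin := fun h => hne (by rw [h])
  exact Set.ncard_lt_ncard ((K.totalSupport_antinefClosure_ssubset hqO
    hu.isAntinefClosure).trans_subset (K.totalSupport_branch_subset hD hq))

theorem chain_length_le {D : K.Div} (hD : K.Antinef D) (k : ℕ) (s : ℕ → K.Div) (h0 : s 0 = D)
    (hs : ∀ i < k, K.NextDivisor (s i) (s (i + 1))) : k ≤ (K.totalSupport D).ncard := by
  have h : ∀ i ≤ k, K.Antinef (s i) ∧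
      (K.totalSupport (s i)).ncard + i ≤ (K.totalSupport D).ncard := by
    intro i
    induction i with
    | zero => exact fun _ => by simp [h0, hD]
    | succ i ih =>
      intro hi
      obtain ⟨hA, hc⟩ := ih (by omega)
      have := (hs i hi).ncard_lt hA
      exact ⟨(hs i hi).antinef, by omega⟩
  have := (h k le_rfl).2
  omega

variable {K}

/-- Every execution of the algorithm from the state `s` has at most `n` steps. -/
def StepsLE (f : K.ContactFamily) (s : K.State) (n : ℕ) : Prop :=
  ∀ (k : ℕ) (t : ℕ → K.State), t 0 = s → (∀ i < k, K.Step f (t i) (t (i + 1))) → k ≤ n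

variable {f : K.ContactFamily}

theorem StepsLE.mono {s : K.State} {m n : ℕ} (h : StepsLE f s m) (hmn : m ≤ n) : StepsLE f s n :=
  fun k t h0 ht => (h k t h0 ht).trans hmn

theorem stepsLE_succ {s : K.State} {n : ℕ} (h : ∀ s', K.Step f s s' → StepsLE f s' n) :
    StepsLE f s (n + 1) := by
  intro k t h0 ht
  cases k with
  | zero => exact Nat.zero_le _
  | succ k =>
    have h1 := ht 0 (Nat.succ_pos _)
    rw [h0] at h1
    exact Nat.succ_le_succ (h _ h1 k (fun i => t (i + 1)) rfl fun i hi => ht (i + 1) (by omega))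

/-- The number of passes of unloading depends only on the divisor it is applied to. -/
theorem Unloads.exists_stepsLE {C C' : K.Div} (h : K.Unloads C C') :
    ∃ u : ℕ, ∀ (f : K.ContactFamily) (D : K.Div) (q : K.pts) (todo : List K.pts)
      (acc : Set holGerms) (σ : List K.Frame) (n : ℕ),
      StepsLE f (.select D q todo acc C' σ) n →
        StepsLE f (.unload D q todo acc C σ) (n + u) := by
  induction h with
  | final C hC =>
    refine ⟨1, fun f D q todo acc σ n hn => stepsLE_succ fun s' hs => ?_⟩
    cases hs with
    | unloadAgain _ _ _ _ _ _ h => exact absurd hC h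
    | unloadStop => exact hn
  | again C C' hC _ ih =>
    obtain ⟨u, hu⟩ := ih
    refine ⟨u + 1, fun f D q todo acc σ n hn => stepsLE_succ fun s' hs => ?_⟩
    cases hs with
    | unloadAgain => exact hu f D q todo acc σ n hn
    | unloadStop _ _ _ _ _ _ h => exact absurd h hC

/-- The loop over the simple summands takes a bounded number of steps for each of them, if the
recursive calls take at most `N` steps up to their return and unloading at most `U`. The bound `n`
is for the steps after the loop has returned. -/
theorem stepsLE_loop {D : K.Div} {U N : ℕ}
    (hU : ∀ q, K.branch q ≠ K.branch K.origin → ∃ C,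
      K.Unloads (K.branch q + K.strict K.origin) C ∧
      ∀ (todo : List K.pts) (acc : Set holGerms) (σ : List K.Frame) (n : ℕ),
        StepsLE f (.select D q todo acc C σ) n →
          StepsLE f (.unload D q todo acc (K.branch q + K.strict K.origin) σ) (n + U))
    (hN : ∀ C, K.NextDivisor D C → ∀ (σ : List K.Frame) (n : ℕ),
      (∀ G, StepsLE f (.ret G σ) n) → StepsLE f (.start C σ) (n + N))
    {σ : List K.Frame} {n : ℕ} (hn : ∀ G, StepsLE f (.ret G σ) n) (todo : List K.pts)
    (htodo : ∀ q ∈ todo, 0 < K.excess D q) (acc : Set holGerms) :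
    StepsLE f (.loop D todo acc σ) (n + 1 + todo.length * (N + U + 3)) := by
  induction todo generalizing acc with
  | nil =>
    rw [List.length_nil, zero_mul]
    refine stepsLE_succ fun s' hs => ?_
    cases hs
    exact hn _
  | cons q todo ih =>
    have ih' := ih fun r hr => htodo r (List.mem_cons_of_mem q hr)
    set m := n + 1 + todo.length * (N + U + 3) with hm
    have hlen : n + 1 + (q :: todo).length * (N + U + 3) = m + 1 + N + 1 + U + 1 := by
      rw [List.length_cons, hm]
      ring
    rw [hlen]
    refine stepsLE_succ fun s' hs => ?_
    cases hs with
    | maximalIdeal => exact (ih' _).mono (by omega)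
    | enterUnload _ _ _ _ _ hne =>
      obtain ⟨C, hC, hsel⟩ := hU q hne
      refine hsel todo acc σ _ (stepsLE_succ fun s' hs => ?_)
      cases hs with
      | selectCall =>
        refine hN C ⟨q, htodo q List.mem_cons_self, hne, hC⟩ _ _ fun G =>
          stepsLE_succ fun s' hs => ?_
        cases hs
        exact ih' _

/-- The bound is stated for a start on an arbitrary stack `σ`, and relative to a bound `n` for the
steps after the return to `σ`, so that it applies to recursive calls. -/
theorem exists_stepsLE_start (K : Cluster) (m : ℕ) : ∃ N : ℕ, ∀ (f : K.ContactFamily) (D : K.Div),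
    K.Antinef D → (K.totalSupport D).ncard < m → ∀ (σ : List K.Frame) (n : ℕ),
      (∀ G, StepsLE f (.ret G σ) n) → StepsLE f (.start D σ) (n + N) := by
  choose C hC using fun q : K.pts => K.exists_unloads (K.branch q + K.strict K.origin)
  choose u hu using fun q => (hC q).exists_stepsLE
  induction m with
  | zero => exact ⟨0, fun f D _ h => absurd h (Nat.not_lt_zero _)⟩
  | succ m ih =>
    obtain ⟨N, hN⟩ := ih
    refine ⟨1 + Fintype.card K.pts * (N + (∑ q, u q) + 3) + 1, fun f D hD hm σ n hn =>
      stepsLE_succ fun s' hs => ?_⟩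
    cases hs with
    | decompose _ _ todo hnd hmem =>
      refine (stepsLE_loop (U := ∑ q, u q) (N := N) (fun q _ => ⟨C q, hC q, ?_⟩) ?_ hn todo
        (fun q hq => (hmem q).mp hq) _).mono ?_
      · intro todo acc σ n h
        refine (hu q f D q todo acc σ n h).mono (Nat.add_le_add_left ?_ n)
        exact Finset.single_le_sum (f := u) (fun _ _ => Nat.zero_le _) (Finset.mem_univ q)
      · intro C' hC' σ n h
        have := hC'.ncard_lt hD
        exact hN f C' hC'.antinef (by omega) σ n h
      · have := Nat.mul_le_mul_right (N + (∑ q, u q) + 3) hnd.length_le_card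
        change _ ≤ n + (1 + Fintype.card K.pts * (N + (∑ q, u q) + 3))
        omega

theorem stepsLE_ret_nil (G : Set holGerms) : StepsLE f (.ret G []) 0 := by
  intro k t h0 ht
  by_contra! hk
  have h := ht 0 hk
  rw [h0] at h
  cases h

end Cluster

end PlaneCluster

theorem proposition4p2 (K : PlaneCluster.Cluster) :
    -- the antinef closure of `B_q + E_O` has smaller support, and multiplicity zero at `q`
    (∀ q : K.pts, K.branch q ≠ K.branch K.origin →
      ∃ C : K.Div, K.Unloads (K.branch q + K.strict K.origin) C ∧
        K.IsAntinefClosure (K.branch q + K.strict K.origin) C ∧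
        K.mult (K.branch q) q = 1 ∧ K.mult C q = 0 ∧
        K.totalSupport C ⊂ K.totalSupport (K.branch q) ∧
        (K.totalSupport C).ncard < (K.totalSupport (K.branch q)).ncard) ∧
    ∀ D : K.Div, K.Antinef D →
      -- the divisors occurring in the successive recursive calls form finite chains
      (∃ N : ℕ, ∀ (k : ℕ) (s : ℕ → K.Div), s 0 = D →
        (∀ i < k, K.NextDivisor (s i) (s (i + 1))) → k ≤ N) ∧
      -- every execution of the algorithm on `D` ends after a bounded number of elementary steps
      ∃ N : ℕ, ∀ f : K.ContactFamily, K.IsMaximalContact f →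
        ∀ (k : ℕ) (s : ℕ → K.State), s 0 = .start D [] →
          (∀ i < k, K.Step f (s i) (s (i + 1))) → k ≤ N := by
  refine ⟨fun q hq => ?_, fun D hD => ⟨⟨_, K.chain_length_le hD⟩, ?_⟩⟩
  · have hqO : q ≠ K.origin := fun h => hq (by rw [h])
    obtain ⟨C, hC⟩ := K.exists_unloads (K.branch q + K.strict K.origin)
    have hcl := hC.isAntinefClosure
    have hss := K.totalSupport_antinefClosure_ssubset hqO hcl
    exact ⟨C, hC, hcl, K.mult_branch_self q,
      K.mult_antinefClosure_eq_zero hqO hcl fun h => h.2 rfl, hss, Set.ncard_lt_ncard hss⟩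
  · obtain ⟨N, hN⟩ := PlaneCluster.Cluster.exists_stepsLE_start K ((K.totalSupport D).ncard + 1)
    exact ⟨0 + N, fun f _ => hN f D hD (Nat.lt_succ_self _) [] 0 fun G =>
      PlaneCluster.Cluster.stepsLE_ret_nil G⟩
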